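/- Let $X$ and $Y$ be Polish spaces with their Borel $\sigma$-algebras, and let $\mu$ and $\nu$ be Borel probability measures on $X$ and $Y$ respectively. Let $F$ be a multifunction from $X$ to $Y$, that is, an assignment to each $x\in X$ of a (possibly empty) subset $F(x)\subseteq Y$, and write $F^{-1}B:=\{x\in X: F(x)\cap B\neq\varnothing\}$ for $B\subseteq Y$. Suppose that $F$ is measurable, i.e. $F^{-1}B$ is Borel for every Borel set $B\subseteq Y$, and that its graph $\{(x,y)\in X\times Y: y\in F(x)\}$ is closed in $X\times Y$. A disintegration of $\mu$ along $F$ with respect to $\nu$ is a family $(\mu_y)_{y\in Y}$ of Borel probability measures on $X$ such that (i) $y\mapsto\mu_y(A)$ is Borel measurable for every Borel set $A\subseteq X$; (ii) $\mu_y(F^{-1}\{y\})=1$ for $\nu$-almost every $y\in Y$; (iii) $\mu(A)=\int_Y\mu_y(A)\,\nu(dy)$ for every Borel set $A\subseteq X$. Then a disintegration of $\mu$ along $F$ with respect to $\nu$ exists if and only if $\mu(F^{-1}U)\geq\nu(U)$ for every open set $U\subseteq Y$. -/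

import Mathlib

open MeasureTheory Set
open scoped ENNReal

/-- The inverse image `F⁻¹B = {x | F(x) ∩ B ≠ ∅}` of a set `B` under a multifunction `F`, that is,
under an assignment of a (possibly empty) set `F x` to each point `x`. -/
def multiPreimage {X Y : Type*} (F : X → Set Y) (B : Set Y) : Set X :=
  {x | (F x ∩ B).Nonempty}

/-- The graph `{(x, y) | y ∈ F(x)}` of a multifunction. -/
def multiGraph {X Y : Type*} (F : X → Set Y) : Set (X × Y) :=
  {p | p.2 ∈ F p.1}

/-- A multifunction is measurable if inverse images of measurable sets are measurable. -/
def MeasurableMultifunction {X Y : Type*} [MeasurableSpace X] [MeasurableSpace Y]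
    (F : X → Set Y) : Prop :=
  ∀ B : Set Y, MeasurableSet B → MeasurableSet (multiPreimage F B)

/-- The fibre `F⁻¹{y}` consists of the points `x` with `y ∈ F(x)`. -/
theorem multiPreimage_singleton {X Y : Type*} (F : X → Set Y) (y : Y) :
    multiPreimage F {y} = {x | y ∈ F x} := by
  ext x
  simp [multiPreimage]

/-- `κ` is a disintegration of `μ` along the multifunction `F` with respect to `ν`: a measurable
family of probability measures, with `κ y` supported on the fibre `F⁻¹{y}` for `ν`-almost every
`y`, whose mixture over `ν` is `μ`. -/
structure IsMultiDisintegration {X Y : Type*} [MeasurableSpace X] [MeasurableSpace Y]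
    (μ : Measure X) (ν : Measure Y) (F : X → Set Y) (κ : Y → ProbabilityMeasure X) : Prop where
  measurable : ∀ A : Set X, MeasurableSet A → Measurable fun y => (κ y : Measure X) A
  supported : ∀ᵐ y ∂ν, (κ y : Measure X) (multiPreimage F {y}) = 1
  formula : ∀ A : Set X, MeasurableSet A → μ A = ∫⁻ y, (κ y : Measure X) A ∂ν

open scoped CompactlySupported ProbabilityTheory

/-! A disintegration is a conditional law of a coupling of μ and ν carried by the graph, so
sufficiency amounts to Strassen's theorem, proved by duality. If f(x) + g(y) ≥ 0 on the graph, then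
F⁻¹{-g > t} ⊆ {f > t}; the hypothesis on open sets and the layer-cake formula give ∫ f dμ + ∫ g dν ≥
0. On a compact space this positivity yields the coupling, by Riesz extension and Riesz–Markov.
Polish spaces are embedded in Hilbert cubes; the closure of the embedded graph gains no points over
X × Y, because the graph is closed. -/

/-- A linear functional `L` that is nonnegative on every `v` whose image `T v` is a nonnegative
continuous function on a compact space `K` is represented by a finite measure on `K`, provided the
range of `T` contains the constant function `1`. -/
theorem exists_measure_integral_eq_of_nonneg {K V : Type*}
    [TopologicalSpace K] [CompactSpace K] [T2Space K] [MeasurableSpace K] [BorelSpace K]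
    [AddCommGroup V] [Module ℝ V] (T : V →ₗ[ℝ] C(K, ℝ)) (L : V →ₗ[ℝ] ℝ)
    (hL : ∀ v, (∀ k, 0 ≤ T v k) → 0 ≤ L v) (e : V) (he : T e = 1) :
    ∃ π : Measure K, IsFiniteMeasure π ∧ ∀ v, ∫ k, T v k ∂π = L v := by
  -- Extending on `V × C(K, ℝ)` instead of `C(K, ℝ)` avoids having to descend `L` to the range of
  -- `T`.
  let s : PointedCone ℝ (V × C(K, ℝ)) :=
    { carrier := {p | ∀ k, 0 ≤ T p.1 k + p.2 k}
      zero_mem' := by simp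
      smul_mem' := by
        rintro c p hp k
        have := mul_nonneg c.2 (hp k)
        change 0 ≤ T ((c : ℝ) • p.1) k + (c : ℝ) * p.2 k
        rw [map_smul, ContinuousMap.smul_apply, smul_eq_mul]
        linarith
      add_mem' := by
        intro p q hp hq k
        have := add_nonneg (hp k) (hq k)
        simp only [Prod.fst_add, map_add, ContinuousMap.add_apply, Prod.snd_add]
        linarith }
  let f : (V × C(K, ℝ)) →ₗ.[ℝ] ℝ :=
    { domain := Submodule.prod ⊤ ⊥
      toFun := (L.comp (LinearMap.fst ℝ V C(K, ℝ))).comp (Submodule.subtype _) }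
  obtain ⟨g, hgf, hg⟩ := riesz_extension s f
    (by
      rintro ⟨⟨v, φ⟩, hv⟩ hs
      obtain rfl : φ = 0 := (Submodule.mem_prod.1 hv).2
      exact hL v fun k => by simpa using hs k)
    (by
      rintro ⟨v, φ⟩
      refine ⟨⟨(‖φ‖ • e - v, 0), by simp [f]⟩, fun k => ?_⟩
      have := neg_le_of_abs_le (φ.norm_coe_le_norm k)
      simp [he]
      linarith)
  have hgL : ∀ v, g (v, 0) = L v := fun v => hgf ⟨(v, 0), by simp [f]⟩
  let Λ : C_c(K, ℝ) →ₚ[ℝ] ℝ := PositiveLinearMap.mk₀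
    { toFun := fun φ => g (0, (φ : C(K, ℝ)))
      map_add' := fun φ ψ => by
        rw [← map_add]; congr 1; ext <;> simp
      map_smul' := fun c φ => by
        rw [RingHom.id_apply, ← map_smul]; congr 1; ext <;> simp }
    (fun φ hφ => hg _ fun k => by simpa using hφ k)
  refine ⟨RealRMK.rieszMeasure Λ, inferInstance, fun v => ?_⟩
  have h1 : ∫ k, T v k ∂(RealRMK.rieszMeasure Λ) = g (0, T v) :=
    RealRMK.integral_rieszMeasure Λ (CompactlySupportedContinuousMap.continuousMapEquiv (T v))
  -- Both `(-v, T v)` and its negative lie in the cone, so `g` vanishes there.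
  have h2 : 0 ≤ g (-v, T v) := hg _ fun k => by simp
  have h3 : 0 ≤ g (v, -T v) := hg _ fun k => by simp
  have h4 : g (-v, T v) = g (0, T v) - g (v, 0) := by rw [← map_sub]; simp
  have h5 : g (v, -T v) = g (v, 0) - g (0, T v) := by rw [← map_sub]; simp
  rw [h1, ← hgL]
  linarith

/-- Stochastic domination of the laws of `g` and `f` orders their means. -/
theorem integral_le_integral_of_measure_lt_le {X Y : Type*} [MeasurableSpace X] [MeasurableSpace Y]
    {μ : Measure X} [IsProbabilityMeasure μ] {ν : Measure Y} [IsProbabilityMeasure ν]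
    {f : X → ℝ} {g : Y → ℝ} (hf : Integrable f μ) (hg : Integrable g ν) (c : ℝ)
    (hcf : ∀ x, c ≤ f x) (hcg : ∀ y, c ≤ g y)
    (h : ∀ t, ν {y | t < g y} ≤ μ {x | t < f x}) : ∫ y, g y ∂ν ≤ ∫ x, f x ∂μ := by
  have hf' : Integrable (fun x => f x - c) μ := hf.sub (integrable_const c)
  have hg' : Integrable (fun y => g y - c) ν := hg.sub (integrable_const c)
  have hf0 : 0 ≤ᵐ[μ] fun x => f x - c := .of_forall fun x => sub_nonneg.2 (hcf x)
  have hg0 : 0 ≤ᵐ[ν] fun y => g y - c := .of_forall fun y => sub_nonneg.2 (hcg y)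
  have key : ∫ y, (g y - c) ∂ν ≤ ∫ x, (f x - c) ∂μ := by
    rw [← ENNReal.ofReal_le_ofReal_iff (integral_nonneg_of_ae hf0),
      ofReal_integral_eq_lintegral_ofReal hg' hg0, ofReal_integral_eq_lintegral_ofReal hf' hf0,
      lintegral_eq_lintegral_meas_lt ν hg0 hg'.aemeasurable,
      lintegral_eq_lintegral_meas_lt μ hf0 hf'.aemeasurable]
    refine lintegral_mono fun t => ?_
    simpa only [lt_sub_iff_add_lt] using h (t + c)
  rw [integral_sub hg (integrable_const c), integral_sub hf (integrable_const c)] at key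
  simpa using key

/-- Kantorovich-type criterion for a coupling carried by a closed subset of a product of compact
metrizable spaces. -/
theorem exists_coupling_of_compactSpace {A B : Type*}
    [TopologicalSpace A] [CompactSpace A] [PolishSpace A] [MeasurableSpace A] [BorelSpace A]
    [TopologicalSpace B] [CompactSpace B] [PolishSpace B] [MeasurableSpace B] [BorelSpace B]
    (α : Measure A) [IsProbabilityMeasure α] (β : Measure B) [IsProbabilityMeasure β]
    {S : Set (A × B)} (hS : IsClosed S)
    (H : ∀ (f : C(A, ℝ)) (g : C(B, ℝ)), (∀ p ∈ S, 0 ≤ f p.1 + g p.2) →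
      0 ≤ ∫ a, f a ∂α + ∫ b, g b ∂β) :
    ∃ π : Measure (A × B), π.fst = α ∧ π.snd = β ∧ π Sᶜ = 0 := by
  -- The measure is built on `S` itself, so its image charges nothing outside `S`.
  have : CompactSpace S := isCompact_iff_compactSpace.1 hS.isCompact
  have intA (f : C(A, ℝ)) : Integrable f α :=
    (BoundedContinuousFunction.mkOfCompact f).integrable α
  have intB (g : C(B, ℝ)) : Integrable g β :=
    (BoundedContinuousFunction.mkOfCompact g).integrable β
  let p₁ : C(S, A) := ⟨fun p => p.1.1, by fun_prop⟩
  let p₂ : C(S, B) := ⟨fun p => p.1.2, by fun_prop⟩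
  let T : C(A, ℝ) × C(B, ℝ) →ₗ[ℝ] C(S, ℝ) :=
    { toFun := fun v => v.1.comp p₁ + v.2.comp p₂
      map_add' := fun v w => by ext; simp; ring
      map_smul' := fun c v => by ext; simp }
  let L : C(A, ℝ) × C(B, ℝ) →ₗ[ℝ] ℝ :=
    { toFun := fun v => ∫ a, v.1 a ∂α + ∫ b, v.2 b ∂β
      map_add' := fun v w => by
        simp only [Prod.fst_add, Prod.snd_add, ContinuousMap.add_apply]
        rw [integral_add (intA _) (intA _), integral_add (intB _) (intB _)]
        ring
      map_smul' := fun c v => by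
        simp [integral_const_mul, mul_add] }
  obtain ⟨π, hπ, hπT⟩ := exists_measure_integral_eq_of_nonneg T L
    (fun v hv => H v.1 v.2 fun p hp => hv ⟨p, hp⟩) (1, 0) (by ext; simp [T])
  refine ⟨π.map Subtype.val, ?_, ?_, ?_⟩
  · rw [Measure.fst, Measure.map_map measurable_fst measurable_subtype_coe]
    refine ext_of_forall_integral_eq_of_IsFiniteMeasure fun f => ?_
    rw [integral_map (by fun_prop) (by fun_prop)]
    simpa [T, L, p₁] using hπT (f.toContinuousMap, 0)
  · rw [Measure.snd, Measure.map_map measurable_snd measurable_subtype_coe]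
    refine ext_of_forall_integral_eq_of_IsFiniteMeasure fun f => ?_
    rw [integral_map (by fun_prop) (by fun_prop)]
    simpa [T, L, p₂] using hπT (0, f.toContinuousMap)
  · rw [Measure.map_apply measurable_subtype_coe hS.measurableSet.compl]
    simp

/-- A coupling of image measures under measurable embeddings comes from a coupling of the original
measures. -/
theorem exists_coupling_of_map {X Y A B : Type*} [MeasurableSpace X] [MeasurableSpace Y]
    [MeasurableSpace A] [MeasurableSpace B] {μ : Measure X} {ν : Measure Y} {i : X → A} {j : Y → B}
    (hi : MeasurableEmbedding i) (hj : MeasurableEmbedding j) {π : Measure (A × B)}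
    (hfst : π.fst = μ.map i) (hsnd : π.snd = ν.map j) :
    ∃ ρ : Measure (X × Y), ρ.fst = μ ∧ ρ.snd = ν ∧ ρ.map (Prod.map i j) = π := by
  have hij : MeasurableEmbedding (Prod.map i j) := hi.prodMap hj
  have hmap : (π.comap (Prod.map i j)).map (Prod.map i j) = π := by
    -- Both marginals live on the ranges, so restricting to the product of the ranges loses no mass.
    rw [hij.map_comap, Measure.restrict_eq_self_of_ae_mem]
    have h1 : ∀ᵐ p ∂π, p.1 ∈ range i := by
      have : ∀ᵐ a ∂π.fst, a ∈ range i := by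
        rw [hfst, hi.ae_map_iff]; simp
      exact ae_of_ae_map measurable_fst.aemeasurable this
    have h2 : ∀ᵐ p ∂π, p.2 ∈ range j := by
      have : ∀ᵐ a ∂π.snd, a ∈ range j := by
        rw [hsnd, hj.ae_map_iff]; simp
      exact ae_of_ae_map measurable_snd.aemeasurable this
    filter_upwards [h1, h2] with p hp1 hp2
    rw [range_prodMap]
    exact ⟨hp1, hp2⟩
  refine ⟨π.comap (Prod.map i j), ?_, ?_, hmap⟩
  · rw [← hi.comap_map (π.comap (Prod.map i j)).fst, ← hi.comap_map μ, ← hfst]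
    nth_rw 2 [← hmap]
    rw [Measure.fst, Measure.fst, Measure.map_map hi.measurable measurable_fst,
      Measure.map_map measurable_fst hij.measurable]
    rfl
  · rw [← hj.comap_map (π.comap (Prod.map i j)).snd, ← hj.comap_map ν, ← hsnd]
    nth_rw 2 [← hmap]
    rw [Measure.snd, Measure.snd, Measure.map_map hj.measurable measurable_snd,
      Measure.map_map measurable_snd hij.measurable]
    rfl

/-- Strassen's theorem: a closed graph carries a coupling of `μ` and `ν` as soon as
`ν U ≤ μ (F⁻¹ U)` for all open sets `U`. -/
theorem exists_coupling_multiGraph {X Y : Type*}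
    [TopologicalSpace X] [PolishSpace X] [MeasurableSpace X] [BorelSpace X]
    [TopologicalSpace Y] [PolishSpace Y] [MeasurableSpace Y] [BorelSpace Y]
    (μ : Measure X) [IsProbabilityMeasure μ] (ν : Measure Y) [IsProbabilityMeasure ν]
    {F : X → Set Y} (hgraph : IsClosed (multiGraph F))
    (h : ∀ U : Set Y, IsOpen U → ν U ≤ μ (multiPreimage F U)) :
    ∃ ρ : Measure (X × Y), ρ.fst = μ ∧ ρ.snd = ν ∧ ∀ᵐ p ∂ρ, p ∈ multiGraph F := by
  let _ := TopologicalSpace.upgradeIsCompletelyMetrizable X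
  let _ := TopologicalSpace.upgradeIsCompletelyMetrizable Y
  obtain ⟨i, hi⟩ := Metric.PiNatEmbed.exists_embedding_to_hilbert_cube (X := X)
  obtain ⟨j, hj⟩ := Metric.PiNatEmbed.exists_embedding_to_hilbert_cube (X := Y)
  have hi' : MeasurableEmbedding i := hi.continuous.measurableEmbedding hi.injective
  have hj' : MeasurableEmbedding j := hj.continuous.measurableEmbedding hj.injective
  have hij : Topology.IsEmbedding (Prod.map i j) := hi.prodMap hj
  have := Measure.isProbabilityMeasure_map (μ := μ) hi'.measurable.aemeasurable
  have := Measure.isProbabilityMeasure_map (μ := ν) hj'.measurable.aemeasurable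
  obtain ⟨π, hπ₁, hπ₂, hπ⟩ := exists_coupling_of_compactSpace (μ.map i) (ν.map j)
    (S := closure (Prod.map i j '' multiGraph F)) isClosed_closure (by
      intro f g hfg
      rw [hi'.integral_map, hj'.integral_map]
      have intf : Integrable (fun x => f (i x)) μ :=
        ((BoundedContinuousFunction.mkOfCompact f).compContinuous ⟨i, hi.continuous⟩).integrable μ
      have intg : Integrable (fun y => -g (j y)) ν :=
        (((BoundedContinuousFunction.mkOfCompact g).compContinuous
          ⟨j, hj.continuous⟩).integrable ν).neg
      have key : ∫ y, -g (j y) ∂ν ≤ ∫ x, f (i x) ∂μ := by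
        refine integral_le_integral_of_measure_lt_le intf intg (-(‖f‖ + ‖g‖))
          (fun x => ?_) (fun y => ?_) fun t => ?_
        · have := neg_le_of_abs_le (f.norm_coe_le_norm (i x))
          linarith [norm_nonneg g]
        · have := le_of_abs_le (g.norm_coe_le_norm (j y))
          linarith [norm_nonneg f]
        · refine (h _ (isOpen_lt continuous_const
            (g.continuous.comp hj.continuous).neg)).trans (measure_mono ?_)
          rintro x ⟨y, hyF, hy⟩
          have := hfg (i x, j y) (subset_closure ⟨(x, y), hyF, rfl⟩)
          change t < -g (j y) at hy
          change t < f (i x)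
          change 0 ≤ f (i x) + g (j y) at this
          linarith
      rw [integral_neg] at key
      linarith)
  obtain ⟨ρ, hρ₁, hρ₂, hρ⟩ := exists_coupling_of_map hi' hj' hπ₁ hπ₂
  refine ⟨ρ, hρ₁, hρ₂, ?_⟩
  have hmem : ∀ᵐ q ∂ρ.map (Prod.map i j), q ∈ closure (Prod.map i j '' multiGraph F) := by
    rw [hρ]; exact hπ
  filter_upwards [ae_of_ae_map (hi'.prodMap hj').measurable.aemeasurable hmem] with p hp
  have : p ∈ closure (multiGraph F) := by
    rw [hij.isInducing.closure_eq_preimage_closure_image]; exact hp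
  rwa [hgraph.closure_eq] at this

/-- The kernel disintegrating a coupling carried by the graph is a disintegration along the
multifunction. -/
theorem exists_isMultiDisintegration_of_coupling {X Y : Type*}
    [MeasurableSpace X] [StandardBorelSpace X] [MeasurableSpace Y]
    {μ : Measure X} [IsProbabilityMeasure μ] {ν : Measure Y} {F : X → Set Y}
    {ρ : Measure (X × Y)} (hfst : ρ.fst = μ) (hsnd : ρ.snd = ν)
    (hρ : ∀ᵐ p ∂ρ, p ∈ multiGraph F) :
    ∃ κ : Y → ProbabilityMeasure X, IsMultiDisintegration μ ν F κ := by
  have : Nonempty X := nonempty_of_isProbabilityMeasure μ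
  have : IsProbabilityMeasure ρ := ⟨by
    rw [← Measure.fst_univ, hfst, measure_univ]⟩
  have : IsProbabilityMeasure (ρ.map Prod.swap) :=
    Measure.isProbabilityMeasure_map measurable_swap.aemeasurable
  -- `condKernel` conditions on the first coordinate, hence the swap.
  have hdis : ν ⊗ₘ (ρ.map Prod.swap).condKernel = ρ.map Prod.swap := by
    have := (ρ.map Prod.swap).disintegrate (ρ.map Prod.swap).condKernel
    rwa [Measure.fst_map_swap, hsnd] at this
  have : IsProbabilityMeasure ν := by rw [← hsnd]; infer_instance
  refine ⟨fun y => ⟨(ρ.map Prod.swap).condKernel y, inferInstance⟩, ?_, ?_, ?_⟩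
  · intro A hA
    exact ProbabilityTheory.Kernel.measurable_coe _ hA
  · have hae : ∀ᵐ q ∂(ν ⊗ₘ (ρ.map Prod.swap).condKernel), q.1 ∈ F q.2 := by
      rw [hdis]
      exact (MeasurableEquiv.prodComm (α := X) (β := Y)).measurableEmbedding.ae_map_iff.2 hρ
    filter_upwards [Measure.ae_ae_of_ae_compProd hae] with y hy
    rw [multiPreimage_singleton]
    change (ρ.map Prod.swap).condKernel y {x | y ∈ F x} = 1
    rw [measure_congr (t := univ) (Filter.eventuallyEq_univ.2 hy), measure_univ]
  · intro A hA
    have h1 : (ν ⊗ₘ (ρ.map Prod.swap).condKernel).snd A = μ A := by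
      rw [hdis, Measure.snd_map_swap, hfst]
    rw [← h1, Measure.snd_apply hA, Measure.compProd_apply (measurable_snd hA)]
    rfl

/-- For y ∈ U the fibre F⁻¹{y} lies in F⁻¹U, so κ_y(F⁻¹U) dominates the indicator of U almost
everywhere; integrate over ν. -/
theorem IsMultiDisintegration.measure_le {X Y : Type*} [MeasurableSpace X] [MeasurableSpace Y]
    {μ : Measure X} {ν : Measure Y} {F : X → Set Y} {κ : Y → ProbabilityMeasure X}
    (hκ : IsMultiDisintegration μ ν F κ) {U : Set Y} (hU : MeasurableSet U)
    (hFU : MeasurableSet (multiPreimage F U)) : ν U ≤ μ (multiPreimage F U) := by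
  rw [hκ.formula _ hFU, ← lintegral_indicator_one hU]
  refine lintegral_mono_ae ?_
  filter_upwards [hκ.supported] with y hy
  by_cases hyU : y ∈ U
  · rw [indicator_of_mem hyU, Pi.one_apply, ← hy]
    exact measure_mono fun x ⟨z, hzF, hz⟩ => ⟨z, hzF, by rwa [mem_singleton_iff.1 hz]⟩
  · simp [hyU]

theorem theorem2p4 {X Y : Type*}
    [TopologicalSpace X] [PolishSpace X] [MeasurableSpace X] [BorelSpace X]
    [TopologicalSpace Y] [PolishSpace Y] [MeasurableSpace Y] [BorelSpace Y]
    (μ : Measure X) [IsProbabilityMeasure μ] (ν : Measure Y) [IsProbabilityMeasure ν]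
    (F : X → Set Y) (hF : MeasurableMultifunction F) (hgraph : IsClosed (multiGraph F)) :
    (∃ κ : Y → ProbabilityMeasure X, IsMultiDisintegration μ ν F κ) ↔
      ∀ U : Set Y, IsOpen U → ν U ≤ μ (multiPreimage F U) := by
  refine ⟨?_, fun h => ?_⟩
  · rintro ⟨κ, hκ⟩ U hU
    exact hκ.measure_le hU.measurableSet (hF U hU.measurableSet)
  · obtain ⟨ρ, h₁, h₂, hρ⟩ := exists_coupling_multiGraph μ ν hgraph h
    exact exists_isMultiDisintegration_of_coupling h₁ h₂ hρ
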